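/- Let $q$ be a prime power and consider a linear SDMM (secure distributed matrix multiplication) scheme over $\mathbb{F}_q$ with $N$ workers: the inputs $A$ and $B$ are cut into an $m\times p$ and a $p\times n$ grid of blocks $A_1,\dots,A_{mp}$ of size $a\times b$ and $B_1,\dots,B_{pn}$ of size $b\times c$, random padding matrices $R_1,\dots,R_X$ and $S_1,\dots,S_X$ are appended, and with generator matrices $F$ and $G$ of size $(mp+X)\times N$ and $(pn+X)\times N$ one puts $\widetilde A=(A_1,\dots,A_{mp},R_1,\dots,R_X)F$ and $\widetilde B=(B_1,\dots,B_{pn},S_1,\dots,S_X)G$. The correct answer of worker $i$ is $\widetilde C_i=\widetilde A_i\widetilde B_i\in\mathbb{F}_q^{a\times c}$. Let $\mathcal{C}_A,\mathcal{C}_B\subseteq\mathbb{F}_q^N$ be the row spaces of $F,G$, and let $\mathcal{C}_A\star\mathcal{C}_B$ be the span of all coordinatewise products of a word of $\mathcal{C}_A$ and a word of $\mathcal{C}_B$. Suppose that $\mathcal{C}_A\star\mathcal{C}_B=\{(f(\alpha_1),\dots,f(\alpha_N)) : f\in\mathbb{F}_q[x],\ \deg f<k\}$ is a Reed–Solomon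 code, with distinct $\alpha_1,\dots,\alpha_N\in\mathbb{F}_q$ and $k\le N$, and that its minimum distance is $D$. Let $\mathcal{E}\subseteq[N]$ be a set of at most $D-2$ Byzantine workers (so $D\ge 2$). The user receives $Y_i=\widetilde C_i+Z_i$, where $Z_i=0$ for $i\notin\mathcal{E}$, and where the errors $Z_i$, $i\in\mathcal{E}$, are independent, the tuple $(Z_i)_i$ is independent of the inputs and the padding, and either every $Z_i$ with $i\in\mathcal{E}$ is uniform on $\mathbb{F}_q^{a\times c}$ or every $Z_i$ with $i\in\mathcal{E}$ is uniform on the nonzero matrices in $\mathbb{F}_q^{a\times c}$. Let $\ell\ge1$ and choose $\ell$ distinct matrix positions; the vectors of the entries of $Y_1,\dots,Y_N$ in these positions form a received word $y^{(1)},\dots,y^{(\ell)}\in\mathbb{F}_q^N$ of the $\ell$-interleaved code of $\mathcal{C}_A\star\mathcal{C}_B$. Collaborative decoding is the following algorithm, which knows neither $\mathcal{E}$ nor the inputs. Compute the syndromes $\sigma^{(r)}_s=\sum_{j}w_j\alpha_j^s y^{(r)}_j$ for $0\le s<N-k$, with $w_j=\prod_{i\ne j}(\alpha_j-\alpha_i)^{-1}$.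 Find the least $\tau$ for which there is a monic polynomial $\Lambda=\sum_{h=0}^{\tau}\Lambda_hx^h$ of degree $\tau$ with $\sum_{h=0}^{\tau}\Lambda_h\sigma^{(r)}_{s+h}=0$ for all $1\le r\le\ell$ and all $s\ge 0$ with $s+\tau<N-k$. If, for this $\tau$, $\Lambda$ is not unique or does not have exactly $\tau$ roots among $\alpha_1,\dots,\alpha_N$, declare a failure. Otherwise treat the positions $j$ with $\Lambda(\alpha_j)=0$ as erasures: output the unique tuple of matrices that agrees with $(Y_i)_i$ in the other positions and whose entries in each matrix position form a word of $\mathcal{C}_A\star\mathcal{C}_B$, and declare a failure if there is no unique such tuple. Then the probability that this algorithm does not output $(\widetilde C_1,\dots,\widetilde C_N)$ is at most $$\left(\frac{q^\ell-q^{-1}}{q^\ell-1}\right)^{D-2}\cdot\frac{q^{D-2-\ell}}{q-1}.$$ -/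

import Mathlib

open MeasureTheory ProbabilityTheory

namespace SDMM

/-! ### Linear codes -/

/-- The star product of two linear codes of length `N`: the span of the coordinatewise products
`c ⋆ d` (`c * d` is the coordinatewise product). -/
def starProduct {K : Type*} [Field K] {N : ℕ} (C D : Submodule K (Fin N → K)) :
    Submodule K (Fin N → K) :=
  Submodule.span K {x | ∃ c ∈ C, ∃ d ∈ D, x = c * d}

/-- The Reed-Solomon code of all vectors `(f(α₁), …, f(α_N))` with `f` a polynomial of degree less
than `k`. The evaluation points `α` are meant to be distinct and `k ≤ N`. -/
noncomputable def reedSolomon {K : Type*} [Field K] {N : ℕ} (α : Fin N → K) (k : ℕ) :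
    Submodule K (Fin N → K) :=
  (Polynomial.degreeLT K k).map (LinearMap.pi fun i => Polynomial.leval (α i))

/-- `D` is the minimum distance of the linear code `C`, i.e. the least Hamming weight of a nonzero
codeword. (The zero code has no minimum distance.) -/
def IsMinDistance {K : Type*} [Field K] [DecidableEq K] {N : ℕ}
    (C : Submodule K (Fin N → K)) (D : ℕ) : Prop :=
  IsLeast {w : ℕ | ∃ c ∈ C, c ≠ 0 ∧ hammingNorm c = w} D

/-- The matrix code of `C`: the `N`-tuples of `a × c` matrices such that for each matrix position
the vector of the entries in that position is a codeword of `C`. -/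
def matrixCode {K : Type*} [Field K] {N : ℕ} (C : Submodule K (Fin N → K)) (a c : ℕ) :
    Set (Fin N → Matrix (Fin a) (Fin c) K) :=
  {Y | ∀ u v, (fun i => Y i u v) ∈ C}

/-! ### Linear SDMM schemes -/

/-- The `(i, j)` block of a matrix that is cut into an `m × p` grid of blocks of size `a × b`. -/
def block {K : Type*} {m p a b : ℕ} (A : Matrix (Fin (m * a)) (Fin (p * b)) K)
    (ij : Fin m × Fin p) : Matrix (Fin a) (Fin b) K :=
  fun u v => A (finProdFinEquiv (ij.1, u)) (finProdFinEquiv (ij.2, v))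

/-- A linear SDMM scheme over `K` with `N` workers, partitioning parameters `m, p, n` and `X` random
padding matrices for each factor, given by its two generator matrices `F` (of size
`(mp + X) × N`) and `G` (of size `(pn + X) × N`). -/
structure LinearScheme (K : Type*) (m p n X N : ℕ) where
  F : Matrix ((Fin m × Fin p) ⊕ Fin X) (Fin N) K
  G : Matrix ((Fin p × Fin n) ⊕ Fin X) (Fin N) K

namespace LinearScheme

variable {K : Type*} [Field K] {m p n X N : ℕ}

/-- The code `C_A`, generated by the rows of `F`. -/
def codeA (𝒮 : LinearScheme K m p n X N) : Submodule K (Fin N → K) :=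
  Submodule.span K (Set.range fun j => 𝒮.F j)

/-- The code `C_B`, generated by the rows of `G`. -/
def codeB (𝒮 : LinearScheme K m p n X N) : Submodule K (Fin N → K) :=
  Submodule.span K (Set.range fun j => 𝒮.G j)

/-- The encoded matrices `(A₁, …, A_{mp}, R₁, …, R_X) F`. -/
def encodeA (𝒮 : LinearScheme K m p n X N) {a b : ℕ}
    (A : Matrix (Fin (m * a)) (Fin (p * b)) K) (R : Fin X → Matrix (Fin a) (Fin b) K)
    (i : Fin N) : Matrix (Fin a) (Fin b) K :=
  ∑ j, 𝒮.F j i • Sum.elim (block A) R j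

/-- The encoded matrices `(B₁, …, B_{pn}, S₁, …, S_X) G`. -/
def encodeB (𝒮 : LinearScheme K m p n X N) {b c : ℕ}
    (B : Matrix (Fin (p * b)) (Fin (n * c)) K) (S : Fin X → Matrix (Fin b) (Fin c) K)
    (i : Fin N) : Matrix (Fin b) (Fin c) K :=
  ∑ j, 𝒮.G j i • Sum.elim (block B) S j

/-- The correct answer of worker `i`: the product of the two encoded matrices sent to it. -/
def answer (𝒮 : LinearScheme K m p n X N) {a b c : ℕ}
    (A : Matrix (Fin (m * a)) (Fin (p * b)) K) (B : Matrix (Fin (p * b)) (Fin (n * c)) K)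
    (R : Fin X → Matrix (Fin a) (Fin b) K) (S : Fin X → Matrix (Fin b) (Fin c) K)
    (i : Fin N) : Matrix (Fin a) (Fin c) K :=
  𝒮.encodeA A R i * 𝒮.encodeB B S i

end LinearScheme

/-! ### Collaborative decoding of interleaved Reed-Solomon codes -/

section Decoder

variable {K : Type*} [Field K] {N : ℕ}

/-- The `ℓ × N` matrix whose rows are the vectors of the entries of `Y` in the `ℓ` matrix positions
listed by `ι`. If `Y` is in the matrix code of `C`, it is in the `ℓ`-interleaved code of `C`. -/
def interleave {a c ℓ : ℕ} (ι : Fin ℓ ↪ Fin a × Fin c)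
    (Y : Fin N → Matrix (Fin a) (Fin c) K) : Matrix (Fin ℓ) (Fin N) K :=
  fun r j => Y j (ι r).1 (ι r).2

/-- The `s`-th syndrome of `y` with respect to the code `reedSolomon α k`, whose parity checks are
`(w_j α_j ^ s)_j` for `s < N - k`, with `w_j = ∏_{i ≠ j} (α_j - α_i)⁻¹`. -/
noncomputable def syndrome (α : Fin N → K) (y : Fin N → K) (s : ℕ) : K :=
  ∑ j, Lagrange.nodalWeight Finset.univ α j * α j ^ s * y j

/-- `Λ` is monic of degree `τ` and solves the key equations of all `ℓ` rows of the received word `W`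
simultaneously: the coefficients of `Λ` are those of a linear recurrence of length `τ` which is
satisfied by each of the `ℓ` syndrome sequences of length `N - k`. -/
def SolvesKeyEquations (α : Fin N → K) (k : ℕ) {ℓ : ℕ} (W : Matrix (Fin ℓ) (Fin N) K) (τ : ℕ)
    (Λ : Polynomial K) : Prop :=
  Λ.Monic ∧ Λ.natDegree = τ ∧
    ∀ (r : Fin ℓ) (s : ℕ), s + τ < N - k →
      ∑ h ∈ Finset.range (τ + 1), Λ.coeff h * syndrome α (W r) (s + h) = 0

/-- The least length of a linear recurrence that is common to all `ℓ` syndrome sequences. -/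
noncomputable def shortestLength (α : Fin N → K) (k : ℕ) {ℓ : ℕ}
    (W : Matrix (Fin ℓ) (Fin N) K) : ℕ :=
  sInf {τ | ∃ Λ, SolvesKeyEquations α k W τ Λ}

open Classical in
/-- Collaborative error location in the `ℓ`-interleaved code of `reedSolomon α k`: if the shortest
solution `Λ` of the simultaneous key equations is unique and has as many roots among the evaluation
points as its degree, then the positions of these roots are returned; otherwise a failure is
declared. -/
noncomputable def locateErrors (α : Fin N → K) (k : ℕ) {ℓ : ℕ}
    (W : Matrix (Fin ℓ) (Fin N) K) : Option (Finset (Fin N)) :=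
  if h : ∃! Λ, SolvesKeyEquations α k W (shortestLength α k W) Λ then
    let L : Finset (Fin N) := Finset.univ.filter fun j => h.choose.eval (α j) = 0
    if L.card = shortestLength α k W then some L else none
  else none

open Classical in
/-- Erasure decoding in the matrix code of `C`: the codeword which agrees with `Y` outside the set
`L` of erased positions, if there is exactly one, and a failure otherwise. -/
noncomputable def decodeErasures (C : Submodule K (Fin N → K)) {a c : ℕ} (L : Finset (Fin N))
    (Y : Fin N → Matrix (Fin a) (Fin c) K) : Option (Fin N → Matrix (Fin a) (Fin c) K) :=
  if h : ∃! V, V ∈ matrixCode C a c ∧ ∀ i ∉ L, V i = Y i then some h.choose else none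

/-- The error correction algorithm: the error positions are located by collaborative decoding of
the interleaved word formed by the `ℓ` chosen matrix positions; these positions are then treated as
erasures for all matrix positions. `none` is a declared failure. -/
noncomputable def collaborativeDecode (α : Fin N → K) (k : ℕ) {a c ℓ : ℕ}
    (ι : Fin ℓ ↪ Fin a × Fin c) (Y : Fin N → Matrix (Fin a) (Fin c) K) :
    Option (Fin N → Matrix (Fin a) (Fin c) K) :=
  (locateErrors α k (interleave ι Y)).bind fun L => decodeErasures (reedSolomon α k) L Y

end Decoder

/-- Matrices over a finite field form a finite set, with the discrete σ-algebra. -/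
instance matrixMeasurableSpace {I J K : Type*} : MeasurableSpace (Matrix I J K) := ⊤

instance matrixDiscreteMeasurableSpace {I J K : Type*} :
    DiscreteMeasurableSpace (Matrix I J K) := ⟨fun _ => trivial⟩

end SDMM

namespace SDMM

/-! ### Decoding succeeds when the error columns are linearly independent. -/

section Decoding

open Polynomial

variable {K : Type*} [Field K] {N : ℕ}

/-! Restrict each error `Z i`, `i ∈ E`, to the `ℓ` chosen positions, giving a column in `K^ℓ`. If
these columns are linearly independent, decoding succeeds: the key equation at `s = 0` is a linear
relation among them with coefficients `w_j Λ(α_j)`, so `Λ` vanishes on `E`, and the shortest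
solution is the nodal polynomial of `E` (`locateErrors_eq_some`). Since `|E| < D`, erasure decoding
then returns the true answers (`decodeErasures_eq_some`). A fixed nontrivial relation holds with
probability at most `1 / (q^ℓ - 1)`. Relations matter only up to scaling, so a union bound over
projective points gives `(q^t - 1) / ((q - 1)(q^ℓ - 1))` with `t = |E|`
(`measureReal_not_linearIndependent_le`). An elementary inequality bounds this by the stated
expression (`pow_sub_one_div_mul_inv_le`). -/

theorem mem_reedSolomon {α : Fin N → K} {k : ℕ} {y : Fin N → K} :
    y ∈ reedSolomon α k ↔ ∃ f ∈ degreeLT K k, ∀ i, f.eval (α i) = y i := by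
  simp [reedSolomon, Submodule.mem_map, funext_iff]

theorem syndrome_add (α : Fin N → K) (y z : Fin N → K) (s : ℕ) :
    syndrome α (y + z) s = syndrome α y s + syndrome α z s := by
  simp [syndrome, mul_add, Finset.sum_add_distrib]

/-- By Lagrange interpolation the syndrome is the coefficient of `x^(N-1)` in `x^s f`, whose degree
is below `N - 1`. -/
theorem syndrome_eq_zero {α : Fin N → K} (hα : Function.Injective α) {k : ℕ} {y : Fin N → K}
    (hy : y ∈ reedSolomon α k) {s : ℕ} (hs : s < N - k) : syndrome α y s = 0 := by
  obtain ⟨f, hf, hfy⟩ := mem_reedSolomon.1 hy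
  rcases eq_or_ne f 0 with rfl | hf0
  · simp [syndrome, ← hfy]
  have hfk : f.natDegree < k := (natDegree_lt_iff_degree_lt hf0).2 (mem_degreeLT.1 hf)
  have hnat : (X ^ s * f).natDegree < N - 1 := by
    rw [natDegree_X_pow_mul _ hf0]; omega
  have hdeg : (X ^ s * f).degree < ((Finset.univ : Finset (Fin N)).card : WithBot ℕ) := by
    rw [Finset.card_fin]
    refine (natDegree_lt_iff_degree_lt (mul_ne_zero (pow_ne_zero s X_ne_zero) hf0)).1 ?_
    omega
  have h := Lagrange.coeff_eq_sum (v := α) hα.injOn hdeg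
  rw [Finset.card_fin, coeff_eq_zero_of_natDegree_lt hnat] at h
  rw [h, syndrome]
  refine Finset.sum_congr rfl fun j _ => ?_
  simp only [Lagrange.nodalWeight, Finset.prod_inv_distrib, eval_mul, eval_pow, eval_X, hfy]
  rw [div_eq_mul_inv]; ring

theorem sum_coeff_mul_syndrome (α : Fin N → K) (y : Fin N → K) (Λ : K[X]) (s : ℕ) :
    ∑ h ∈ Finset.range (Λ.natDegree + 1), Λ.coeff h * syndrome α y (s + h) =
      ∑ j, Lagrange.nodalWeight Finset.univ α j * α j ^ s * Λ.eval (α j) * y j := by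
  simp only [syndrome, Finset.mul_sum, eval_eq_sum_range, Finset.sum_mul]
  rw [Finset.sum_comm]
  refine Finset.sum_congr rfl fun j _ => Finset.sum_congr rfl fun h _ => ?_
  rw [pow_add]; ring

variable {α : Fin N → K} {k ℓ : ℕ} {U e : Matrix (Fin ℓ) (Fin N) K} {E : Finset (Fin N)}

theorem solvesKeyEquations_iff
    (hα : Function.Injective α) (hU : ∀ r, U r ∈ reedSolomon α k) {τ : ℕ} {Λ : K[X]} :
    SolvesKeyEquations α k (U + e) τ Λ ↔ Λ.Monic ∧ Λ.natDegree = τ ∧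
      ∀ (r : Fin ℓ) (s : ℕ), s + τ < N - k →
        ∑ j, Lagrange.nodalWeight Finset.univ α j * α j ^ s * Λ.eval (α j) * e r j = 0 := by
  unfold SolvesKeyEquations
  refine and_congr_right fun _ => and_congr_right fun hτ => forall_congr' fun r =>
    forall_congr' fun s => imp_congr_right fun hs => ?_
  rw [← sum_coeff_mul_syndrome, hτ]
  refine Eq.congr_left (Finset.sum_congr rfl fun h hh => ?_)
  have hh' := Finset.mem_range.1 hh
  rw [show (U + e) r = U r + e r from rfl, syndrome_add,
    syndrome_eq_zero hα (hU r) (by omega), zero_add]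

theorem solvesKeyEquations_nodal
    (hα : Function.Injective α) (hU : ∀ r, U r ∈ reedSolomon α k)
    (he : ∀ r, ∀ j ∉ E, e r j = 0) :
    SolvesKeyEquations α k (U + e) E.card (Lagrange.nodal E α) := by
  refine (solvesKeyEquations_iff hα hU).2
    ⟨Lagrange.nodal_monic, Lagrange.natDegree_nodal, fun r s _ => Finset.sum_eq_zero fun j _ => ?_⟩
  by_cases hj : j ∈ E
  · simp [Lagrange.eval_nodal_at_node hj]
  · simp [he r j hj]

theorem SolvesKeyEquations.eval_eq_zero
    (hα : Function.Injective α) (hU : ∀ r, U r ∈ reedSolomon α k)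
    (he : ∀ r, ∀ j ∉ E, e r j = 0) (hcard : E.card < N - k)
    (hlin : LinearIndependent K fun (j : {j // j ∈ E}) r => e r j) {τ : ℕ} {Λ : K[X]}
    (h : SolvesKeyEquations α k (U + e) τ Λ) (hτ : τ ≤ E.card) {j : Fin N} (hj : j ∈ E) :
    Λ.eval (α j) = 0 := by
  obtain ⟨-, -, hsum⟩ := (solvesKeyEquations_iff hα hU).1 h
  have hzero : ∑ i : {j // j ∈ E}, (Lagrange.nodalWeight Finset.univ α i * Λ.eval (α i)) •
      (fun r => e r i) = 0 := by
    funext r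
    -- The equation `s = 0` suffices; it is available because `τ ≤ |E| < N - k`.
    have h0 := hsum r 0 (by omega)
    rw [← Finset.sum_subset (Finset.subset_univ E)
      (fun i _ hi => by simp [he r i hi]), ← Finset.sum_coe_sort] at h0
    simpa using h0
  have := Fintype.linearIndependent_iff.1 hlin _ hzero ⟨j, hj⟩
  exact (mul_eq_zero.1 this).resolve_left
    (Lagrange.nodalWeight_ne_zero hα.injOn (Finset.mem_univ j))

/-- A shorter solution would have more roots than its degree. -/
theorem shortestLength_eq_card
    (hα : Function.Injective α) (hU : ∀ r, U r ∈ reedSolomon α k)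
    (he : ∀ r, ∀ j ∉ E, e r j = 0) (hcard : E.card < N - k)
    (hlin : LinearIndependent K fun (j : {j // j ∈ E}) r => e r j) : shortestLength α k (U + e) = E.card := by
  refine IsLeast.csInf_eq ⟨⟨_, solvesKeyEquations_nodal hα hU he⟩, ?_⟩
  rintro τ ⟨Λ, hΛ⟩
  by_contra! hlt
  refine hΛ.1.ne_zero (Polynomial.eq_zero_of_degree_lt_of_eval_index_eq_zero E hα.injOn ?_
    fun j hj => hΛ.eval_eq_zero hα hU he hcard hlin hlt.le hj)
  exact (natDegree_lt_iff_degree_lt hΛ.1.ne_zero).1 (hΛ.2.1.trans_lt hlt)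

theorem SolvesKeyEquations.eq_nodal
    (hα : Function.Injective α) (hU : ∀ r, U r ∈ reedSolomon α k)
    (he : ∀ r, ∀ j ∉ E, e r j = 0) (hcard : E.card < N - k)
    (hlin : LinearIndependent K fun (j : {j // j ∈ E}) r => e r j) {Λ : K[X]}
    (h : SolvesKeyEquations α k (U + e) E.card Λ) : Λ = Lagrange.nodal E α := by
  have hdeg : Λ.degree = E.card := by rw [degree_eq_natDegree h.1.ne_zero, h.2.1]
  refine Polynomial.eq_of_degree_le_of_eval_index_eq E hα.injOn hdeg.le ?_ ?_ fun j hj => ?_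
  · rw [hdeg, Lagrange.degree_nodal]
  · rw [h.1, Lagrange.nodal_monic]
  · rw [h.eval_eq_zero hα hU he hcard hlin le_rfl hj, Lagrange.eval_nodal_at_node hj]

theorem locateErrors_eq_some
    (hα : Function.Injective α) (hU : ∀ r, U r ∈ reedSolomon α k)
    (he : ∀ r, ∀ j ∉ E, e r j = 0) (hcard : E.card < N - k)
    (hlin : LinearIndependent K fun (j : {j // j ∈ E}) r => e r j) : locateErrors α k (U + e) = some E := by
  have hlen := shortestLength_eq_card hα hU he hcard hlin
  have hex : ∃! Λ, SolvesKeyEquations α k (U + e) (shortestLength α k (U + e)) Λ := by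
    rw [hlen]
    exact ⟨_, solvesKeyEquations_nodal hα hU he,
      fun Λ hΛ => SolvesKeyEquations.eq_nodal hα hU he hcard hlin hΛ⟩
  have hch : hex.choose = Lagrange.nodal E α := by
    -- Generalizing `τ` avoids rewriting inside the type of `hex`, on which `hex.choose` depends.
    have hsol : ∀ τ, τ = E.card → SolvesKeyEquations α k (U + e) τ hex.choose →
        hex.choose = Lagrange.nodal E α := by
      rintro _ rfl h
      exact h.eq_nodal hα hU he hcard hlin
    exact hsol _ hlen hex.choose_spec.1
  have hL : ∀ j, j ∈ E ↔ hex.choose.eval (α j) = 0 := fun j => by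
    simp [hch, Lagrange.eval_nodal, Finset.prod_eq_zero_iff, sub_eq_zero, hα.eq_iff]
  classical
  rw [locateErrors, dif_pos hex]
  simp only [← hL, Finset.filter_univ_mem]
  rw [if_pos hlen.symm]

/-- Two candidates differ, in each matrix position, by a codeword supported on `E`, of weight below
`D`. -/
theorem decodeErasures_eq_some [DecidableEq K] {C : Submodule K (Fin N → K)} {D : ℕ}
    (hD : IsMinDistance C D) {a c : ℕ} (hE : E.card < D)
    {V Y : Fin N → Matrix (Fin a) (Fin c) K} (hV : V ∈ matrixCode C a c)
    (hVY : ∀ i ∉ E, V i = Y i) : decodeErasures C E Y = some V := by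
  have huniq : ∀ V', (V' ∈ matrixCode C a c ∧ ∀ i ∉ E, V' i = Y i) → V' = V := by
    rintro V' ⟨hV', hVY'⟩
    funext i
    ext u v
    by_contra hne
    have hmem : (fun i => V' i u v) - (fun i => V i u v) ∈ C := C.sub_mem (hV' u v) (hV u v)
    have hle := hD.2 ⟨_, hmem, fun h0 => hne (sub_eq_zero.1 (congrFun h0 i)), rfl⟩
    refine absurd (hle.trans (Finset.card_le_card (t := E) fun j hj => ?_)) (not_le.2 hE)
    by_contra hjE
    simp [hVY j hjE, hVY' j hjE] at hj
  have hex : ∃! V, V ∈ matrixCode C a c ∧ ∀ i ∉ E, V i = Y i := ⟨V, ⟨hV, hVY⟩, huniq⟩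
  rw [decodeErasures, dif_pos hex, huniq _ hex.choose_spec.1]

/-- The Singleton bound, witnessed by the nodal polynomial of `k - 1` evaluation points. With `|E| ≤
D - 2` it yields `|E| < N - k`. -/
theorem IsMinDistance.le_of_reedSolomon [DecidableEq K] (hα : Function.Injective α) (hk : k ≤ N)
    {D : ℕ} (hD : IsMinDistance (reedSolomon α k) D) : D + k ≤ N + 1 := by
  rcases Nat.eq_zero_or_pos k with rfl | hk0
  · obtain ⟨y, hy, hy0, -⟩ := hD.1
    obtain ⟨f, hf, hfy⟩ := mem_reedSolomon.1 hy
    have hf0 : f = 0 := by simpa [mem_degreeLT] using hf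
    exact absurd (_root_.funext fun i => by simp [← hfy, hf0]) hy0
  · obtain ⟨T, hT⟩ := Finset.exists_subset_card_eq
      (show k - 1 ≤ (Finset.univ : Finset (Fin N)).card by rw [Finset.card_fin]; omega)
    have hy : (fun i => (Lagrange.nodal T α).eval (α i)) ∈ reedSolomon α k :=
      mem_reedSolomon.2 ⟨_, by
        rw [mem_degreeLT, Lagrange.degree_nodal, hT.2]; exact_mod_cast Nat.sub_lt hk0 one_pos,
        fun _ => rfl⟩
    have hne : ∀ i, (Lagrange.nodal T α).eval (α i) ≠ 0 ↔ i ∈ Tᶜ := fun i => by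
      simp [Lagrange.eval_nodal, Finset.prod_eq_zero_iff, sub_eq_zero, hα.eq_iff]
    have hTc : Tᶜ.card = N - (k - 1) := by rw [Finset.card_compl, hT.2, Fintype.card_fin]
    obtain ⟨i, hi⟩ : Tᶜ.Nonempty := Finset.card_pos.1 (by omega)
    have := hD.2 ⟨_, hy, fun h0 => (hne i).2 hi (congrFun h0 i), rfl⟩
    have hw : hammingNorm (fun i => (Lagrange.nodal T α).eval (α i)) = Tᶜ.card := by
      unfold hammingNorm; congr 1; ext i; simp [hne]
    omega

end Decoding

theorem LinearScheme.answer_mem_matrixCode {K : Type*} [Field K] {m p n X N : ℕ}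
    (𝒮 : LinearScheme K m p n X N) {a b c : ℕ}
    (A : Matrix (Fin (m * a)) (Fin (p * b)) K) (B : Matrix (Fin (p * b)) (Fin (n * c)) K)
    (R : Fin X → Matrix (Fin a) (Fin b) K) (S : Fin X → Matrix (Fin b) (Fin c) K) :
    𝒮.answer A B R S ∈ matrixCode (starProduct 𝒮.codeA 𝒮.codeB) a c := by
  intro u v
  have hsum : (fun i => 𝒮.answer A B R S i u v) =
      ∑ w, (fun i => 𝒮.encodeA A R i u w) * (fun i => 𝒮.encodeB B S i w v) := by
    funext i
    simp [answer, Matrix.mul_apply]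
  rw [hsum]
  refine Submodule.sum_mem _ fun w _ => Submodule.subset_span ⟨_, ?_, _, ?_, rfl⟩
  · have h : (fun i => 𝒮.encodeA A R i u w) = ∑ j, Sum.elim (block A) R j u w • 𝒮.F j := by
      funext i
      simp [encodeA, Matrix.sum_apply, mul_comm]
    rw [h]
    exact Submodule.sum_mem _ fun j _ => Submodule.smul_mem _ _ (Submodule.subset_span ⟨j, rfl⟩)
  · have h : (fun i => 𝒮.encodeB B S i w v) = ∑ j, Sum.elim (block B) S j w v • 𝒮.G j := by
      funext i
      simp [encodeB, Matrix.sum_apply, mul_comm]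
    rw [h]
    exact Submodule.sum_mem _ fun j _ => Submodule.smul_mem _ _ (Submodule.subset_span ⟨j, rfl⟩)

/-! ### Probability that the error columns are dependent. -/

section Probability

/-- All fibres of `π` have the same size `t = |V| / |H|`, and `t (|H| - 1) = |V| - t ≤ |V| - 1 ≤
|s|`. This treats both error laws at once. -/
theorem uniformOn_preimage_singleton_le {V H : Type*} [AddGroup V] [Fintype V] [DecidableEq V]
    [MeasurableSpace V] [MeasurableSingletonClass V] [AddGroup H] [Fintype H] [DecidableEq H]
    (hH : 1 < Fintype.card H) (π : V →+ H) (hπ : Function.Surjective π) (s : Finset V)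
    (hs : Fintype.card V ≤ s.card + 1) (x : H) :
    (uniformOn (s : Set V)).real (π ⁻¹' {x}) ≤ ((Fintype.card H : ℝ) - 1)⁻¹ := by
  set t : Finset V := Finset.univ.filter fun g => π g = x
  have ht : (t : Set V) = π ⁻¹' {x} := by ext; simp [t]
  have hpos : 0 < t.card := Finset.card_pos.2 (by
    obtain ⟨v, hv⟩ := hπ x
    exact ⟨v, by simp [t, hv]⟩)
  have hcard : Fintype.card V = Fintype.card H * t.card := by
    rw [← Finset.card_univ, Finset.card_eq_sum_card_fiberwise (f := π) (t := Finset.univ) (by simp)]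
    rw [Finset.sum_congr rfl fun y _ => AddMonoidHom.card_fiber_eq_of_mem_range π (hπ y) (hπ x)]
    simp [t]
  rw [← ht, measureReal_def, uniformOn_apply_finset, ENNReal.toReal_div, ENNReal.toReal_natCast,
    ENNReal.toReal_natCast]
  have hH' : (0 : ℝ) < Fintype.card H - 1 := by
    have : (1 : ℝ) < Fintype.card H := by exact_mod_cast hH
    linarith
  have h1 : ((s ∩ t).card : ℝ) ≤ t.card := by
    exact_mod_cast Finset.card_le_card Finset.inter_subset_right
  have h2 : (t.card : ℝ) * (Fintype.card H - 1) ≤ s.card := by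
    have h3 : (Fintype.card H : ℝ) * t.card ≤ s.card + 1 := by exact_mod_cast hcard ▸ hs
    have h4 : (1 : ℝ) ≤ t.card := by exact_mod_cast hpos
    linarith
  refine div_le_of_le_mul₀ (by positivity) (by positivity) ?_
  rw [← div_eq_inv_mul, le_div_iff₀ hH']
  exact (mul_le_mul_of_nonneg_right h1 hH'.le).trans h2

variable {Ω : Type*} [MeasurableSpace Ω] {μ : Measure Ω} [IsProbabilityMeasure μ]

theorem measureReal_eq_le_of_indepFun {H : Type*} [Fintype H] [MeasurableSpace H]
    [MeasurableSingletonClass H] {X Y : Ω → H} (hXY : IndepFun X Y μ) (hY : AEMeasurable Y μ)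
    {ε : ℝ} (hε : ∀ x, μ.real (X ⁻¹' {x}) ≤ ε) : μ.real {ω | X ω = Y ω} ≤ ε := by
  have hsub : {ω | X ω = Y ω} ⊆ ⋃ y, X ⁻¹' {y} ∩ Y ⁻¹' {y} := fun ω hω =>
    Set.mem_iUnion.2 ⟨Y ω, hω, rfl⟩
  have hsum : ∑ y, μ.real (Y ⁻¹' {y}) = 1 := by
    have := Measure.isProbabilityMeasure_map (μ := μ) hY
    have h := sum_measureReal_singleton (μ := μ.map Y) Finset.univ
    rw [Finset.coe_univ, probReal_univ] at h
    rw [← h]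
    exact Finset.sum_congr rfl fun y _ =>
      (map_measureReal_apply_of_aemeasurable hY (measurableSet_singleton y)).symm
  calc μ.real {ω | X ω = Y ω} ≤ μ.real (⋃ y, X ⁻¹' {y} ∩ Y ⁻¹' {y}) := measureReal_mono hsub
    _ ≤ ∑ y, μ.real (X ⁻¹' {y} ∩ Y ⁻¹' {y}) := measureReal_iUnion_fintype_le _
    _ ≤ ∑ y, ε * μ.real (Y ⁻¹' {y}) := by
      refine Finset.sum_le_sum fun y _ => ?_
      rw [measureReal_def, hXY.measure_inter_preimage_eq_mul _ _ (measurableSet_singleton y)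
        (measurableSet_singleton y), ENNReal.toReal_mul]
      exact mul_le_mul_of_nonneg_right (hε y) measureReal_nonneg
    _ = ε := by rw [← Finset.mul_sum, hsum, mul_one]

variable {I K V H : Type*} [Fintype I] [Field K] [Fintype V] [MeasurableSpace V]
  [MeasurableSingletonClass V] [AddCommGroup H] [Module K H] [Fintype H]
  {Z : I → Ω → V} {π : V → H} {ε : ℝ}

/-- Where `v i₀ ≠ 0`, the relation forces `π (Z i₀)` to equal a function of the other errors, which
is independent of it. -/
theorem measureReal_sum_smul_eq_zero_le (hindep : iIndepFun Z μ) (hZ : ∀ i, AEMeasurable (Z i) μ)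
    (hε : ∀ i x, μ.real (Z i ⁻¹' (π ⁻¹' {x})) ≤ ε) {v : I → K} (hv : v ≠ 0) :
    μ.real {ω | ∑ i, v i • π (Z i ω) = 0} ≤ ε := by
  classical
  obtain ⟨i₀, hi₀⟩ := Function.ne_iff.1 hv
  let _ : MeasurableSpace H := ⊤
  have : DiscreteMeasurableSpace H := ⟨fun _ => trivial⟩
  let f : (({i₀} : Finset I) → V) → H := fun z => π (z ⟨i₀, Finset.mem_singleton_self i₀⟩)
  let g : (({i₀}ᶜ : Finset I) → V) → H := fun z => -((v i₀)⁻¹ • ∑ i : ({i₀}ᶜ : Finset I), v i • π (z i))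
  have hg : Measurable g := measurable_of_countable g
  have hfg := (hindep.indepFun_finset₀ {i₀} {i₀}ᶜ disjoint_compl_right hZ).comp
    (measurable_of_countable f) hg
  have hgm : AEMeasurable (g ∘ fun ω (i : ({i₀}ᶜ : Finset I)) => Z i ω) μ :=
    hg.comp_aemeasurable (aemeasurable_pi_lambda _ fun i => hZ i)
  refine (measureReal_mono fun ω hω => ?_).trans
    (measureReal_eq_le_of_indepFun hfg hgm fun x => hε i₀ x)
  have hsplit : v i₀ • π (Z i₀ ω) + ∑ i : ({i₀}ᶜ : Finset I), v i • π (Z i ω) = 0 := by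
    rw [Finset.sum_coe_sort ({i₀}ᶜ : Finset I) fun i => v i • π (Z i ω),
      ← Fintype.sum_eq_add_sum_compl i₀ fun i => v i • π (Z i ω)]
    exact hω
  change π (Z i₀ ω) = -((v i₀)⁻¹ • ∑ i : ({i₀}ᶜ : Finset I), v i • π (Z i ω))
  rw [← smul_neg, ← eq_neg_of_add_eq_zero_left hsplit, inv_smul_smul₀ hi₀]

theorem measureReal_not_linearIndependent_le [Fintype K] (hindep : iIndepFun Z μ)
    (hZ : ∀ i, AEMeasurable (Z i) μ) (hε : ∀ i x, μ.real (Z i ⁻¹' (π ⁻¹' {x})) ≤ ε) :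
    μ.real {ω | ¬ LinearIndependent K fun i => π (Z i ω)} ≤
      ((Fintype.card K : ℝ) ^ Fintype.card I - 1) / ((Fintype.card K : ℝ) - 1) * ε := by
  have : Finite (Projectivization K (I → K)) := Quotient.finite _
  have := Fintype.ofFinite (Projectivization K (I → K))
  have hsub : {ω | ¬ LinearIndependent K fun i => π (Z i ω)} ⊆
      ⋃ p : Projectivization K (I → K), {ω | ∑ i, p.rep i • π (Z i ω) = 0} := by
    intro ω hω
    rw [Set.mem_ofPred_eq, Fintype.linearIndependent_iff] at hω
    push Not at hω
    obtain ⟨v, hv, i, hi⟩ := hω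
    have hv0 : v ≠ 0 := fun h => hi (congrFun h i)
    -- Passing to the representative of the line of `v` saves a factor `q - 1` in the union bound.
    obtain ⟨a, ha⟩ := Projectivization.exists_smul_eq_mk_rep K v hv0
    refine Set.mem_iUnion.2 ⟨Projectivization.mk K v hv0, ?_⟩
    rw [Set.mem_ofPred_eq, ← ha]
    have : ∑ i, (a • v) i • π (Z i ω) = (a : K) • ∑ i, v i • π (Z i ω) := by
      rw [Finset.smul_sum]
      exact Finset.sum_congr rfl fun i _ => by
        rw [Pi.smul_apply, Units.smul_def, smul_assoc]
    rw [this, hv, smul_zero]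
  have hq : (1 : ℝ) < Fintype.card K := by exact_mod_cast Fintype.one_lt_card
  have hcard : (Fintype.card (Projectivization K (I → K)) : ℝ) =
      ((Fintype.card K : ℝ) ^ Fintype.card I - 1) / ((Fintype.card K : ℝ) - 1) := by
    have h := Projectivization.card' K (I → K)
    have h1 : 1 ≤ Nat.card K := Nat.card_pos
    rw [Nat.card_fun, Nat.card_eq_fintype_card, Nat.card_eq_fintype_card,
      Nat.card_eq_fintype_card] at *
    rw [eq_div_iff (by linarith), eq_sub_iff_add_eq]
    have h' := congrArg (Nat.cast (R := ℝ)) h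
    push_cast [Nat.cast_sub h1] at h'
    exact h'.symm
  calc _ ≤ _ := measureReal_mono hsub
    _ ≤ ∑ p : Projectivization K (I → K), μ.real {ω | ∑ i, p.rep i • π (Z i ω) = 0} :=
      measureReal_iUnion_fintype_le _
    _ ≤ ∑ _p : Projectivization K (I → K), ε := Finset.sum_le_sum fun p _ =>
      measureReal_sum_smul_eq_zero_le hindep hZ hε p.rep_nonzero
    _ = _ := by rw [Finset.sum_const, nsmul_eq_mul, Finset.card_univ, hcard]

end Probability

/-! ### The closing numerical inequality. -/

theorem one_add_pow_sub_one_mul_le {q β : ℝ} (hq : 1 ≤ q) (hβ : 1 ≤ β) (d : ℕ) :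
    1 + (q ^ d - 1) * β ≤ (1 + (q - 1) * β) ^ d := by
  induction d with
  | zero => simp
  | succ d ih =>
    have h1 : 1 ≤ q ^ d := one_le_pow₀ hq
    rw [pow_succ (1 + (q - 1) * β)]
    refine le_trans ?_ (mul_le_mul_of_nonneg_right ih (by nlinarith))
    -- This is exactly the surplus of `(1 + (q^d - 1)β)(1 + (q - 1)β)` over `1 + (q^(d+1) - 1)β`.
    have : 0 ≤ (q ^ d - 1) * (q - 1) * (β * (β - 1)) :=
      mul_nonneg (mul_nonneg (by linarith) (by linarith)) (mul_nonneg (by linarith) (by linarith))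
    rw [pow_succ]
    nlinarith

theorem pow_sub_one_div_mul_inv_le {q : ℝ} (hq : 1 < q) {ℓ t d : ℕ} (hℓ : 1 ≤ ℓ) (htd : t ≤ d) :
    (q ^ t - 1) / (q - 1) * (q ^ ℓ - 1)⁻¹ ≤
      ((q ^ ℓ - q⁻¹) / (q ^ ℓ - 1)) ^ d * (q ^ ((d : ℤ) - ℓ) / (q - 1)) := by
  have hQ : 1 < q ^ ℓ := one_lt_pow₀ hq (by omega)
  have hq0 : 0 < q := by linarith
  have hQ1 : 0 < q ^ ℓ - 1 := by linarith
  have hq1 : 0 < q - 1 := by linarith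
  have hβ : 1 ≤ q ^ ℓ / (q ^ ℓ - 1) := by rw [le_div_iff₀ hQ1]; linarith
  -- With `β = q^ℓ / (q^ℓ - 1)`, this identity puts the target in the form of the preceding
  -- inequality.
  have hγ : (q ^ ℓ - q⁻¹) / (q ^ ℓ - 1) * q = 1 + (q - 1) * (q ^ ℓ / (q ^ ℓ - 1)) := by
    field_simp; ring
  have hmono : q ^ t ≤ q ^ d := pow_le_pow_right₀ hq.le htd
  have key := one_add_pow_sub_one_mul_le hq.le hβ d
  rw [← hγ, mul_pow] at key
  rw [zpow_sub₀ hq0.ne', zpow_natCast, zpow_natCast]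
  calc (q ^ t - 1) / (q - 1) * (q ^ ℓ - 1)⁻¹
      ≤ (q ^ d - 1) / (q - 1) * (q ^ ℓ - 1)⁻¹ := by gcongr
    _ = ((q ^ d - 1) * (q ^ ℓ / (q ^ ℓ - 1))) / (q ^ ℓ * (q - 1)) := by field_simp
    _ ≤ (((q ^ ℓ - q⁻¹) / (q ^ ℓ - 1)) ^ d * q ^ d) / (q ^ ℓ * (q - 1)) := by
      refine div_le_div_of_nonneg_right ?_ (by positivity)
      linarith
    _ = _ := by field_simp

end SDMM

theorem mainTheorem7 {K : Type*} [Field K] [Fintype K] [DecidableEq K]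
    {m p n X N a b c : ℕ}
    -- a linear SDMM scheme for which `C_A ⋆ C_B` is a Reed-Solomon code of minimum distance `D`
    (𝒮 : SDMM.LinearScheme K m p n X N)
    (α : Fin N → K) (hα : Function.Injective α) (k : ℕ) (hk : k ≤ N)
    (hRS : SDMM.starProduct 𝒮.codeA 𝒮.codeB = SDMM.reedSolomon α k)
    (D : ℕ) (hD : SDMM.IsMinDistance (SDMM.starProduct 𝒮.codeA 𝒮.codeB) D)
    -- the interleaving order and the chosen matrix positions
    (ℓ : ℕ) (hℓ : 1 ≤ ℓ) (ι : Fin ℓ ↪ Fin a × Fin c)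
    {Ω : Type*} [MeasurableSpace Ω] (μ : MeasureTheory.Measure Ω)
    [MeasureTheory.IsProbabilityMeasure μ]
    -- the input matrices and the random padding, with any joint distribution
    (A : Ω → Matrix (Fin (m * a)) (Fin (p * b)) K) (hA : Measurable A)
    (B : Ω → Matrix (Fin (p * b)) (Fin (n * c)) K) (hB : Measurable B)
    (R : Ω → Fin X → Matrix (Fin a) (Fin b) K) (hR : Measurable R)
    (S : Ω → Fin X → Matrix (Fin b) (Fin c) K) (hS : Measurable S)
    -- the Byzantine workers, at most `D - 2` of them
    (E : Finset (Fin N)) (hE : E.card + 2 ≤ D)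
    -- the errors: independent, uniform over all matrices or over all nonzero matrices
    (Z : Fin N → Ω → Matrix (Fin a) (Fin c) K)
    (hZ : ∀ i ∉ E, ∀ ω, Z i ω = 0)
    (hZunif : (∀ i ∈ E, ProbabilityTheory.HasLaw (Z i)
        (ProbabilityTheory.uniformOn Set.univ) μ) ∨
      (∀ i ∈ E, ProbabilityTheory.HasLaw (Z i) (ProbabilityTheory.uniformOn {0}ᶜ) μ))
    (hZindep : ProbabilityTheory.iIndepFun (fun i : {i // i ∈ E} => Z i) μ)
    (hZdata : ProbabilityTheory.IndepFun (fun ω => (A ω, B ω, R ω, S ω))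
      (fun ω (i : Fin N) => Z i ω) μ) :
    -- the probability that the correct answers of all workers are not recovered
    μ.real {ω | SDMM.collaborativeDecode α k ι
          (fun i => 𝒮.answer (A ω) (B ω) (R ω) (S ω) i + Z i ω) ≠
        some (𝒮.answer (A ω) (B ω) (R ω) (S ω))} ≤
      (((Fintype.card K : ℝ) ^ ℓ - (Fintype.card K : ℝ)⁻¹) / ((Fintype.card K : ℝ) ^ ℓ - 1)) ^
          (D - 2) *
        ((Fintype.card K : ℝ) ^ ((D : ℤ) - 2 - (ℓ : ℤ)) / ((Fintype.card K : ℝ) - 1)) := by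

  rw [hRS] at hD
  have hDk := hD.le_of_reedSolomon hα hk
  let π : Matrix (Fin a) (Fin c) K →+ (Fin ℓ → K) :=
    { toFun := fun M r => M (ι r).1 (ι r).2
      map_zero' := rfl
      map_add' := fun _ _ => rfl }
  have hπ : Function.Surjective π := fun x =>
    ⟨fun u v => Function.extend ι x 0 (u, v), funext fun r => ι.injective.extend_apply x 0 r⟩
  have hH : 1 < Fintype.card (Fin ℓ → K) := by
    rw [Fintype.card_fun, Fintype.card_fin]
    exact Nat.one_lt_pow (by omega) Fintype.one_lt_card
  have hε : ∀ (i : {i // i ∈ E}) x,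
      μ.real (Z i ⁻¹' (π ⁻¹' {x})) ≤ ((Fintype.card K : ℝ) ^ ℓ - 1)⁻¹ := by
    intro i x
    have hq : (Fintype.card K : ℝ) ^ ℓ = Fintype.card (Fin ℓ → K) := by simp
    rw [hq]
    rcases hZunif with h | h
    · rw [← map_measureReal_apply_of_aemeasurable (h i i.2).aemeasurable (.of_discrete),
        (h i i.2).map_eq]
      have := SDMM.uniformOn_preimage_singleton_le hH π hπ Finset.univ (Nat.le_succ _) x
      rwa [Finset.coe_univ] at this
    · rw [← map_measureReal_apply_of_aemeasurable (h i i.2).aemeasurable (.of_discrete),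
        (h i i.2).map_eq]
      have := SDMM.uniformOn_preimage_singleton_le hH π hπ {0}ᶜ
        (by rw [Finset.card_compl, Finset.card_singleton]; omega) x
      rwa [Finset.coe_compl, Finset.coe_singleton] at this
  have hmeas : ∀ i : {i // i ∈ E}, AEMeasurable (Z i) μ := fun i =>
    hZunif.elim (fun h => (h i i.2).aemeasurable) fun h => (h i i.2).aemeasurable
  have hfail := SDMM.measureReal_not_linearIndependent_le (K := K) (π := π) hZindep hmeas hε
  have hbound := SDMM.pow_sub_one_div_mul_inv_le (q := Fintype.card K)
    (by exact_mod_cast Fintype.one_lt_card) hℓ (show E.card ≤ D - 2 by omega)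
  rw [Fintype.card_coe] at hfail
  rw [Nat.cast_sub (by omega : 2 ≤ D), Nat.cast_ofNat] at hbound
  refine (measureReal_mono fun ω hω => ?_).trans (hfail.trans hbound)
  -- Failure implies dependence: for each outcome `ω` with independent columns the decoder is
  -- correct, whatever the inputs and padding.
  contrapose! hω
  rw [Set.mem_ofPred_eq, not_not] at hω ⊢
  have hC := 𝒮.answer_mem_matrixCode (A ω) (B ω) (R ω) (S ω)
  rw [hRS] at hC
  have hloc := SDMM.locateErrors_eq_some (k := k) (E := E)
    (U := SDMM.interleave ι (𝒮.answer (A ω) (B ω) (R ω) (S ω)))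
    (e := SDMM.interleave ι fun i => Z i ω) hα (fun r => hC _ _)
    (fun r j hj => by simp [SDMM.interleave, hZ j hj ω]) (by omega) hω
  have hdec := SDMM.decodeErasures_eq_some hD (by omega : E.card < D) hC
    (Y := fun i => 𝒮.answer (A ω) (B ω) (R ω) (S ω) i + Z i ω)
    fun i hi => by rw [hZ i hi ω, add_zero]
  exact (congrArg (Option.bind · _) hloc).trans hdec
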